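/- Let $Q$ be a smooth (Hausdorff, finite-dimensional) manifold without boundary, and let $\tau:A\to Q$ be a smooth real vector bundle of finite rank with a Lie algebroid structure, that is, a vector bundle morphism $\rho:A\to TQ$ over the identity (the anchor) and a Lie bracket $[\cdot,\cdot]_A$ on the space $\Gamma(A)$ of smooth sections with $[X,fY]_A=f[X,Y]_A+\rho(X)(f)\,Y$ for $X,Y\in\Gamma(A)$, $f\in C^\infty(Q)$. Let $\pi:A^*\to Q$ be the dual bundle, and for $X\in\Gamma(A)$ let $\hat X:A^*\to\mathbb R$, $\hat X(\mu)=\langle\mu,X(\pi(\mu))\rangle$. Conventions: $(X\wedge Y)(\alpha,\beta)=\alpha(X)\beta(Y)-\alpha(Y)\beta(X)$; for a vector field $E$ and a bivector field $\Lambda$, $(E\wedge\Lambda)(\alpha,\beta,\gamma)=\alpha(E)\Lambda(\beta,\gamma)+\beta(E)\Lambda(\gamma,\alpha)+\gamma(E)\Lambda(\alpha,\beta)$. In the Schouten–Nijenhuis bracket, $[E,\Lambda]=\mathcal L_E\Lambda$ is the Lie derivative, and for bivector fields the sign is Lichnerowicz's: writing $\{f,g\}_\Lambda=\Lambda(df,dg)$,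 $$[\Lambda,\Lambda](df,dg,dh)=2\big(\{\{f,g\}_\Lambda,h\}_\Lambda+\{\{g,h\}_\Lambda,f\}_\Lambda+\{\{h,f\}_\Lambda,g\}_\Lambda\big).$$ There is exactly one smooth bivector field $\Lambda_{A^*}$ on $A^*$ whose bracket $\{f,g\}_{A^*}=\Lambda_{A^*}(df,dg)$ satisfies $$\{\hat X,\hat Y\}_{A^*}=\widehat{[X,Y]_A},\qquad \{\hat X,f\circ\pi\}_{A^*}=\rho(X)(f)\circ\pi,\qquad \{f\circ\pi,g\circ\pi\}_{A^*}=0$$ for all $X,Y\in\Gamma(A)$ and $f,g\in C^\infty(Q)$; it is a Poisson bivector, $[\Lambda_{A^*},\Lambda_{A^*}]=0$ (the linear Poisson structure on $A^*$ corresponding to the Lie algebroid structure on $A$). On $A^*\times\mathbb R$, with projection $\mathrm{pr}_1$ onto $A^*$ and coordinate $z$ on $\mathbb R$, let $\mathcal R=\partial/\partial z$ be the Reeb vector field and $\Delta^*(\mu,z)=\frac{d}{dt}\big|_{t=0}(\mu+t\mu,z)$ the Liouville vector field, let $\mathrm{pr}_1^*\Lambda_{A^*}$ be the bivector field that is tangent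 to the slices $A^*\times\{z\}$ and equal to $\Lambda_{A^*}$ on each of them, and set $$\Lambda=\mathrm{pr}_1^*\Lambda_{A^*}+\Delta^*\wedge\mathcal R,\qquad E=-\mathcal R.$$ Then $(\Lambda,E)$ is a Jacobi structure on $A^*\times\mathbb R$: $\Lambda$ is a smooth bivector field, $E$ is a smooth vector field, and $$[\Lambda,\Lambda]=2E\wedge\Lambda,\qquad [E,\Lambda]=0.$$ -/

import Mathlib

open Bundle
open scoped Manifold ContDiff

noncomputable section

namespace LieAlgd

/-! ### Vector fields, bivector fields and Schouten brackets on a manifold -/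

section Multivectors

variable {E : Type*} [NormedAddCommGroup E] [NormedSpace ℝ E]
  {H : Type*} [TopologicalSpace H] (I : ModelWithCorners ℝ E H)
  {M : Type*} [TopologicalSpace M] [ChartedSpace H M]

/-- The cotangent space `T*ₓM`. -/
abbrev Cotangent (x : M) : Type _ := TangentSpace I x →L[ℝ] ℝ

/-- The differential `(df)ₓ`, as a covector. -/
def d (f : M → ℝ) (x : M) : Cotangent I x := mfderiv I 𝓘(ℝ, ℝ) f x

/-- A smooth vector field. -/
def IsVectorField [IsManifold I ∞ M] (X : ∀ x : M, TangentSpace I x) : Prop :=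
  ContMDiff I I.tangent ∞ (fun x => (⟨x, X x⟩ : TangentBundle I M))

/-- A field of bilinear forms on the cotangent spaces (a twice contravariant tensor field), with no
regularity. The bivector fields are the alternating smooth ones, see `IsBivectorField`. -/
abbrev BilinField (M : Type*) [TopologicalSpace M] [ChartedSpace H M] : Type _ :=
  ∀ x : M, LinearMap.BilinForm ℝ (Cotangent I x)

/-- The one-form on the domain of the chart at `x₀` which extends the covector `α` at `x₀` and has
constant coefficients in this chart, i.e. the differential of the linear function `α` of the
coordinates. -/
def chartCovector (x₀ : M) (α : Cotangent I x₀) (y : M) : Cotangent I y :=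
  ContinuousLinearMap.comp (show E →L[ℝ] ℝ from α) (mfderiv I 𝓘(ℝ, E) (extChartAt I x₀) y)

/-- The component of a vector field in the chart at `x₀`, along the coordinate direction `α`. -/
def vecComp (X : ∀ x : M, TangentSpace I x) (x₀ : M) (α : Cotangent I x₀) (y : M) : ℝ :=
  chartCovector I x₀ α y (X y)

/-- The component of a twice contravariant tensor field in the chart at `x₀`, along the coordinate
directions `α` and `β`. -/
def bivComp (Λ : BilinField I M) (x₀ : M) (α β : Cotangent I x₀) (y : M) : ℝ :=
  Λ y (chartCovector I x₀ α y) (chartCovector I x₀ β y)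

/-- A smooth bivector field: alternating, with smooth components in the charts. -/
structure IsBivectorField (Λ : BilinField I M) : Prop where
  alt : ∀ x, (Λ x).IsAlt
  smooth : ∀ (x₀ : M) (α β : Cotangent I x₀),
    ContMDiffOn I 𝓘(ℝ, ℝ) ∞ (bivComp I Λ x₀ α β) (chartAt H x₀).source

/-- The bivector field `X ∧ Y`, where `(X ∧ Y)(α, β) = α(X) β(Y) - α(Y) β(X)`. -/
def wedge (X Y : ∀ x : M, TangentSpace I x) : BilinField I M := fun x =>
  LinearMap.mk₂ ℝ (fun α β => α (X x) * β (Y x) - α (Y x) * β (X x))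
    (by intros; simp; ring) (by intros; simp; ring)
    (by intros; simp; ring) (by intros; simp; ring)

/-- The trivector field `X ∧ Λ`. -/
def wedgeBiv (X : ∀ x : M, TangentSpace I x) (Λ : BilinField I M)
    (x : M) (α β γ : Cotangent I x) : ℝ :=
  α (X x) * Λ x β γ + β (X x) * Λ x γ α + γ (X x) * Λ x α β

/-- The Schouten-Nijenhuis bracket `[X, Λ]` of a vector field and a bivector field, which is the Lie
derivative of `Λ` along `X`: `[X, Λ](df, dg) = X(Λ(df, dg)) - Λ(d(X f), dg) - Λ(df, d(X g))`,
evaluated on the coordinate functions of the chart at `x`. -/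
def schoutenVec (X : ∀ x : M, TangentSpace I x) (Λ : BilinField I M)
    (x : M) (α β : Cotangent I x) : ℝ :=
  d I (bivComp I Λ x α β) x (X x)
    - Λ x (d I (vecComp I X x α) x) β - Λ x α (d I (vecComp I X x β) x)

/-- The Schouten-Nijenhuis bracket `[P, Q]` of two bivector fields (with Lichnerowicz's sign):
`[P, Q](df, dg, dh)` is the cyclic sum over `f, g, h` of
`P(d(Q(df, dg)), dh) + Q(d(P(df, dg)), dh)`, evaluated on the coordinate functions of the chart
at `x`. -/
def schouten (P Q : BilinField I M) (x : M) (α β γ : Cotangent I x) : ℝ :=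
  (P x (d I (bivComp I Q x α β) x) γ + Q x (d I (bivComp I P x α β) x) γ)
    + (P x (d I (bivComp I Q x β γ) x) α + Q x (d I (bivComp I P x β γ) x) α)
    + (P x (d I (bivComp I Q x γ α) x) β + Q x (d I (bivComp I P x γ α) x) β)

/-- A Poisson bivector: a smooth bivector field with `[Λ, Λ] = 0`. -/
structure IsPoissonBivector (Λ : BilinField I M) : Prop where
  isBivectorField : IsBivectorField I Λ
  schouten_self : ∀ (x : M) (α β γ : Cotangent I x), schouten I Λ Λ x α β γ = 0

/-- A Jacobi structure `(Λ, X)`: a smooth bivector field `Λ` and a smooth vector field `X` such that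
`[Λ, Λ] = 2 X ∧ Λ` and `[X, Λ] = 0`. -/
structure IsJacobiStructure [IsManifold I ∞ M] (Λ : BilinField I M)
    (X : ∀ x : M, TangentSpace I x) : Prop where
  isBivectorField : IsBivectorField I Λ
  isVectorField : IsVectorField I X
  schouten_self : ∀ (x : M) (α β γ : Cotangent I x),
    schouten I Λ Λ x α β γ = 2 * wedgeBiv I X Λ x α β γ
  schouten_vec : ∀ (x : M) (α β : Cotangent I x), schoutenVec I X Λ x α β = 0

/-- The bivector field `pr₁^* Λ` on `M × ℝ`, for a bivector field `Λ` on `M`: the one that is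
tangent to the slices `M × {z}` and equal to `Λ` on each of them. A covector at `(x, z)` is
restricted to the slice through the differential of the inclusion `y ↦ (y, z)`. -/
def pullbackFst (Λ : BilinField I M) : BilinField (I.prod 𝓘(ℝ, ℝ)) (M × ℝ) := fun p =>
  let ι : TangentSpace I p.1 →L[ℝ] TangentSpace (I.prod 𝓘(ℝ, ℝ)) p :=
    mfderiv I (I.prod 𝓘(ℝ, ℝ)) (fun y : M => (y, p.2)) p.1
  LinearMap.mk₂ ℝ (fun α β : Cotangent (I.prod 𝓘(ℝ, ℝ)) p => Λ p.1 (α.comp ι) (β.comp ι))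
    (by intros; simp) (by intros; simp) (by intros; simp) (by intros; simp)

/-- The Reeb vector field `∂/∂z` on `M × ℝ`. -/
def reeb (p : M × ℝ) : TangentSpace (I.prod 𝓘(ℝ, ℝ)) p :=
  mfderiv 𝓘(ℝ, ℝ) (I.prod 𝓘(ℝ, ℝ)) (fun z : ℝ => (p.1, z)) p.2 (1 : ℝ)

end Multivectors

/-! ### Lie algebroids and the dual bundle -/

section Algebroid

variable {E : Type*} [NormedAddCommGroup E] [NormedSpace ℝ E]
  {H : Type*} [TopologicalSpace H] (I : ModelWithCorners ℝ E H)
  {Q : Type*} [TopologicalSpace Q] [ChartedSpace H Q]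
  (F : Type*) [NormedAddCommGroup F] [NormedSpace ℝ F]
  (A : Q → Type*) [TopologicalSpace (TotalSpace F A)]
  [∀ q, AddCommGroup (A q)] [∀ q, Module ℝ (A q)] [∀ q, TopologicalSpace (A q)]
  [FiberBundle F A] [VectorBundle ℝ F A]

/-- The smooth section `f X`, for a smooth function `f` on the base and a smooth section `X`. -/
def fsmul {I : ModelWithCorners ℝ E H} {F : Type*} [NormedAddCommGroup F] [NormedSpace ℝ F]
    {A : Q → Type*} [TopologicalSpace (TotalSpace F A)]
    [∀ q, AddCommGroup (A q)] [∀ q, Module ℝ (A q)] [∀ q, TopologicalSpace (A q)]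
    [FiberBundle F A] [VectorBundle ℝ F A]
    (f : C^∞⟮I, Q; ℝ⟯) (X : Cₛ^∞⟮I; F, A⟯) : Cₛ^∞⟮I; F, A⟯ :=
  ⟨fun q => f q • X q, f.contMDiff.smul_section X.contMDiff⟩

/-- A Lie algebroid structure on the vector bundle `A → Q`. -/
structure LieAlgebroid [IsManifold I ∞ Q] where
  /-- The anchor `ρ : A → TQ`, a smooth morphism of vector bundles over the identity. -/
  anchor : ∀ q, A q →ₗ[ℝ] TangentSpace I q
  contMDiff_anchor : ContMDiff (I.prod 𝓘(ℝ, F)) I.tangent ∞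
    (fun v : TotalSpace F A => (⟨v.1, anchor v.1 v.2⟩ : TangentBundle I Q))
  /-- The bracket of smooth sections. -/
  bracket : Cₛ^∞⟮I; F, A⟯ →ₗ[ℝ] Cₛ^∞⟮I; F, A⟯ →ₗ[ℝ] Cₛ^∞⟮I; F, A⟯
  bracket_self : ∀ X, bracket X X = 0
  jacobi : ∀ X Y Z, bracket X (bracket Y Z) + bracket Y (bracket Z X) + bracket Z (bracket X Y) = 0
  leibniz : ∀ (X Y : Cₛ^∞⟮I; F, A⟯) (f : C^∞⟮I, Q; ℝ⟯) (q : Q),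
    bracket X (fsmul f Y) q = f q • bracket X Y q + d I f q (anchor q (X q)) • Y q

/-- The fibres of the dual bundle `A* → Q`. -/
abbrev Dual : Q → Type _ := fun q => A q →L[ℝ] Bundle.Trivial Q ℝ q

/-- The total space of the dual bundle `A*`. -/
abbrev DualTotal : Type _ := TotalSpace (F →L[ℝ] ℝ) (Dual A)

/-- The model with corners of the manifold `A*`. -/
abbrev dualModel : ModelWithCorners ℝ (E × (F →L[ℝ] ℝ)) (ModelProd H (F →L[ℝ] ℝ)) :=
  I.prod 𝓘(ℝ, F →L[ℝ] ℝ)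

/-- The fibrewise linear function on `A*` defined by a section `X` of `A`. -/
def hat {I : ModelWithCorners ℝ E H} {F : Type*} [NormedAddCommGroup F] [NormedSpace ℝ F]
    {A : Q → Type*} [TopologicalSpace (TotalSpace F A)]
    [∀ q, AddCommGroup (A q)] [∀ q, Module ℝ (A q)] [∀ q, TopologicalSpace (A q)]
    [FiberBundle F A] [VectorBundle ℝ F A]
    (X : Cₛ^∞⟮I; F, A⟯) (μ : DualTotal F A) : ℝ := μ.2 (X μ.1)

variable [∀ q, IsTopologicalAddGroup (A q)] [∀ q, ContinuousSMul ℝ (A q)]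

/-- `Λ` is the bivector field on `A*` that corresponds to the Lie algebroid structure on `A`: the
bracket `{f, g} = Λ(df, dg)` satisfies `{X^, Y^} = [X, Y]^`, `{X^, f ∘ π} = ρ(X)(f) ∘ π` and
`{f ∘ π, g ∘ π} = 0` for sections `X, Y` of `A` and smooth functions `f, g` on `Q`, where `π` is
the projection of `A*`. -/
structure IsAssociated [IsManifold I ∞ Q] (𝒜 : LieAlgebroid I F A)
    (Λ : BilinField (dualModel I F) (DualTotal F A)) : Prop where
  isBivectorField : IsBivectorField (dualModel I F) Λ
  hat_hat : ∀ (X Y : Cₛ^∞⟮I; F, A⟯) (μ : DualTotal F A),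
    Λ μ (d (dualModel I F) (hat X) μ) (d (dualModel I F) (hat Y) μ) = hat (𝒜.bracket X Y) μ
  hat_base : ∀ (X : Cₛ^∞⟮I; F, A⟯) (f : C^∞⟮I, Q; ℝ⟯) (μ : DualTotal F A),
    Λ μ (d (dualModel I F) (hat X) μ) (d (dualModel I F) (fun ν : DualTotal F A => f ν.1) μ)
      = d I f μ.1 (𝒜.anchor μ.1 (X μ.1))
  base_base : ∀ (f g : C^∞⟮I, Q; ℝ⟯) (μ : DualTotal F A),
    Λ μ (d (dualModel I F) (fun ν : DualTotal F A => f ν.1) μ)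
      (d (dualModel I F) (fun ν : DualTotal F A => g ν.1) μ) = 0

/-- The model with corners of the manifold `A* × ℝ`. -/
abbrev contactModel : ModelWithCorners ℝ ((E × (F →L[ℝ] ℝ)) × ℝ)
    (ModelProd (ModelProd H (F →L[ℝ] ℝ)) ℝ) :=
  (dualModel I F).prod 𝓘(ℝ, ℝ)

/-- The Liouville vector field on `A* × ℝ`: the velocity at `t = 0` of `t ↦ (μ + t μ, z)`. -/
def liouville (p : DualTotal F A × ℝ) : TangentSpace (contactModel I F) p :=
  mfderiv 𝓘(ℝ, ℝ) (contactModel I F)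
    (fun t : ℝ => ((⟨p.1.1, p.1.2 + t • p.1.2⟩ : DualTotal F A), p.2)) 0 (1 : ℝ)

/-- The bivector field `pr₁^* Λ + Δ* ∧ ∂/∂z` on `A* × ℝ`. -/
def contactBivector (Λ : BilinField (dualModel I F) (DualTotal F A)) :
    BilinField (contactModel I F) (DualTotal F A × ℝ) :=
  pullbackFst (dualModel I F) Λ
    + wedge (contactModel I F) (liouville I F A) (reeb (dualModel I F))

end Algebroid

end LieAlgd

end

noncomputable section

namespace LieAlgd

open Filter
open scoped Topology

section Trivialization

variable {E : Type*} [NormedAddCommGroup E] [NormedSpace ℝ E]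
  {H : Type*} [TopologicalSpace H] {I : ModelWithCorners ℝ E H}
  {Q : Type*} [TopologicalSpace Q] [ChartedSpace H Q]
  {F : Type*} [NormedAddCommGroup F] [NormedSpace ℝ F]
  {A : Q → Type*} [TopologicalSpace (TotalSpace F A)]
  [∀ q, AddCommGroup (A q)] [∀ q, Module ℝ (A q)] [∀ q, TopologicalSpace (A q)]
  [FiberBundle F A] [VectorBundle ℝ F A]

theorem contMDiffOn_trivialization_symm [ContMDiffVectorBundle ∞ F A I] (q : Q) (v : F) :
    ContMDiffOn I (I.prod 𝓘(ℝ, F)) ∞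
      (fun x => (⟨x, (trivializationAt F A q).symm x v⟩ : TotalSpace F A))
      (trivializationAt F A q).baseSet := by
  rw [(trivializationAt F A q).contMDiffOn_section_baseSet_iff]
  refine (contMDiffOn_const (c := v)).congr fun x hx => ?_
  simp [(trivializationAt F A q).apply_mk_symm hx]

end Trivialization

section Localization

variable {E : Type*} [NormedAddCommGroup E] [NormedSpace ℝ E] [FiniteDimensional ℝ E]
  {H : Type*} [TopologicalSpace H] {I : ModelWithCorners ℝ E H}
  {Q : Type*} [TopologicalSpace Q] [T2Space Q] [ChartedSpace H Q] [IsManifold I ∞ Q]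

theorem exists_bump {q : Q} {u : Set Q} (hu : u ∈ 𝓝 q) :
    ∃ χ : C^∞⟮I, Q; ℝ⟯, (χ : Q → ℝ) =ᶠ[𝓝 q] 1 ∧ tsupport χ ⊆ u := by
  obtain ⟨χ, -, hχ⟩ := (SmoothBumpFunction.nhds_basis_tsupport (I := I) q).mem_iff.1 hu
  exact ⟨⟨χ, χ.contMDiff⟩, χ.eventuallyEq_one, hχ⟩

theorem exists_contMDiffMap_eventuallyEq {q : Q} {u : Set Q} (hu : IsOpen u) (hq : q ∈ u)
    {g : Q → ℝ} (hg : ContMDiffOn I 𝓘(ℝ, ℝ) ∞ g u) :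
    ∃ f : C^∞⟮I, Q; ℝ⟯, (f : Q → ℝ) =ᶠ[𝓝 q] g := by
  obtain ⟨χ, h1, h2⟩ := exists_bump (I := I) (hu.mem_nhds hq)
  refine ⟨⟨fun x => χ x * g x, contMDiff_of_tsupport fun x hx => ?_⟩, ?_⟩
  · have hx' : x ∈ u := h2 (closure_mono (Function.support_mul_subset_left _ _) hx)
    exact χ.contMDiff.contMDiffAt.mul (hg.contMDiffAt (hu.mem_nhds hx'))
  · filter_upwards [h1] with x hx
    simp [hx]

variable {F : Type*} [NormedAddCommGroup F] [NormedSpace ℝ F]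
  {A : Q → Type*} [TopologicalSpace (TotalSpace F A)]
  [∀ q, AddCommGroup (A q)] [∀ q, Module ℝ (A q)] [∀ q, TopologicalSpace (A q)]
  [FiberBundle F A] [VectorBundle ℝ F A]

theorem exists_section_eventuallyEq {q : Q} {u : Set Q} (hu : IsOpen u) (hq : q ∈ u)
    {s : ∀ q, A q}
    (hs : ContMDiffOn I (I.prod 𝓘(ℝ, F)) ∞ (fun x => (⟨x, s x⟩ : TotalSpace F A)) u) :
    ∃ X : Cₛ^∞⟮I; F, A⟯, ∀ᶠ x in 𝓝 q, X x = s x := by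
  obtain ⟨χ, h1, h2⟩ := exists_bump (I := I) (hu.mem_nhds hq)
  refine ⟨⟨fun x => χ x • s x, 
    ContMDiffOn.smul_section_of_tsupport (ψ := χ) χ.contMDiff.contMDiffOn hu h2 hs⟩, ?_⟩
  filter_upwards [h1] with x hx
  change χ x • s x = s x
  simp [hx]

theorem exists_section_eventuallyEq_symm [ContMDiffVectorBundle ∞ F A I] {q₀ q : Q}
    (hq : q ∈ (trivializationAt F A q₀).baseSet) (v : F) :
    ∃ X : Cₛ^∞⟮I; F, A⟯, ∀ᶠ x in 𝓝 q, X x = (trivializationAt F A q₀).symm x v :=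
  exists_section_eventuallyEq (trivializationAt F A q₀).open_baseSet hq
    (contMDiffOn_trivialization_symm q₀ v)

/-- Near `q`, a section is a combination with smooth coefficients of any sections which extend the
local frame at `q`. -/
theorem exists_coeff_eventuallyEq_sum [ContMDiffVectorBundle ∞ F A I] [FiniteDimensional ℝ F]
    {ι : Type*} [Fintype ι] (b : Module.Basis ι ℝ F) (q : Q) (X : Cₛ^∞⟮I; F, A⟯)
    (Y : ι → Cₛ^∞⟮I; F, A⟯)
    (hY : ∀ i, ∀ᶠ x in 𝓝 q, Y i x = (trivializationAt F A q).symm x (b i)) :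
    ∃ c : ι → C^∞⟮I, Q; ℝ⟯, ∀ᶠ x in 𝓝 q, X x = (∑ i, fsmul (c i) (Y i)) x := by
  set e := trivializationAt F A q
  have hq : q ∈ e.baseSet := mem_baseSet_trivializationAt F A q
  have h1 : ContMDiffOn I 𝓘(ℝ, F) ∞ (fun x => (e ⟨x, X x⟩).2) e.baseSet :=
    (e.contMDiffOn_section_baseSet_iff).1 X.contMDiff.contMDiffOn
  have h2 (i : ι) : ∃ c : C^∞⟮I, Q; ℝ⟯,
      (c : Q → ℝ) =ᶠ[𝓝 q] fun x => b.coord i (e ⟨x, X x⟩).2 :=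
    exists_contMDiffMap_eventuallyEq e.open_baseSet hq
      ((LinearMap.toContinuousLinearMap (b.coord i)).contMDiff.comp_contMDiffOn h1)
  choose c hc using h2
  refine ⟨c, ?_⟩
  filter_upwards [eventually_all.2 hc, eventually_all.2 hY, e.open_baseSet.mem_nhds hq]
    with x hx hy hxe
  have h0 : (∑ i, fsmul (c i) (Y i)) x = ∑ i, fsmul (c i) (Y i) x := by
    rw [← ContMDiffSection.coeAddHom_apply, map_sum, Finset.sum_apply]
    rfl
  rw [h0]
  have h3 (i : ι) : fsmul (c i) (Y i) x = e.symmₗ ℝ x (b.coord i (e ⟨x, X x⟩).2 • b i) := by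
    change c i x • Y i x = _
    rw [hx, hy, map_smul, e.coe_symmₗ hxe]
  simp only [h3]
  rw [← map_sum]
  simp only [Module.Basis.coord_apply]
  rw [b.sum_repr]
  rw [e.coe_symmₗ hxe]
  exact (e.symm_apply_apply_mk hxe (X x)).symm

end Localization

section BaseDerivative

variable {E : Type*} [NormedAddCommGroup E] [NormedSpace ℝ E]
  {H : Type*} [TopologicalSpace H] {I : ModelWithCorners ℝ E H}
  {M : Type*} [TopologicalSpace M] [ChartedSpace H M]

theorem d_congr {f g : M → ℝ} {x : M} (h : f =ᶠ[𝓝 x] g) : d I f x = d I g x :=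
  h.mfderiv_eq

theorem mdifferentiableAt_map (f : C^∞⟮I, M; ℝ⟯) (x : M) : MDifferentiableAt I 𝓘(ℝ, ℝ) f x :=
  f.contMDiff.mdifferentiable (by simp) x

theorem d_add {f g : M → ℝ} {x : M} (hf : MDifferentiableAt I 𝓘(ℝ, ℝ) f x)
    (hg : MDifferentiableAt I 𝓘(ℝ, ℝ) g x) : d I (fun y => f y + g y) x = d I f x + d I g x :=
  mfderiv_add hf hg

theorem d_const_smul {f : M → ℝ} {x : M} (hf : MDifferentiableAt I 𝓘(ℝ, ℝ) f x) (c : ℝ) :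
    d I (fun y => c * f y) x = c • d I f x :=
  const_smul_mfderiv hf c

theorem d_const (c : ℝ) (x : M) : d I (fun _ : M => c) x = 0 :=
  mfderiv_const

theorem contMDiff_d_apply [IsManifold I ∞ M] {f : M → ℝ} (hf : ContMDiff I 𝓘(ℝ, ℝ) ∞ f)
    {X : ∀ x : M, TangentSpace I x} (hX : IsVectorField I X) :
    ContMDiff I 𝓘(ℝ, ℝ) ∞ fun x => d I f x (X x) :=
  (contMDiff_snd_tangentBundle_modelSpace ℝ 𝓘(ℝ, ℝ)).comp
    ((hf.contMDiff_tangentMap (m := ∞) le_rfl).comp hX)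

end BaseDerivative

section Observables

variable {E : Type*} [NormedAddCommGroup E] [NormedSpace ℝ E]
  {H : Type*} [TopologicalSpace H] {I : ModelWithCorners ℝ E H}
  {Q : Type*} [TopologicalSpace Q] [ChartedSpace H Q] [IsManifold I ∞ Q]
  {F : Type*} [NormedAddCommGroup F] [NormedSpace ℝ F]
  {A : Q → Type*} [TopologicalSpace (TotalSpace F A)]
  [∀ q, AddCommGroup (A q)] [∀ q, Module ℝ (A q)] [∀ q, TopologicalSpace (A q)]
  [FiberBundle F A] [VectorBundle ℝ F A]

namespace LieAlgebroid

variable (𝒜 : LieAlgebroid I F A)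

/-- The derivation `f ↦ ρ(X)(f)` of the smooth functions on the base, for a section `X`. -/
def anchorDer : Cₛ^∞⟮I; F, A⟯ →ₗ[ℝ] C^∞⟮I, Q; ℝ⟯ →ₗ[ℝ] C^∞⟮I, Q; ℝ⟯ :=
  LinearMap.mk₂ ℝ
    (fun X f => ⟨fun q => d I f q (𝒜.anchor q (X q)), contMDiff_d_apply f.contMDiff
      (X := fun q => 𝒜.anchor q (X q)) (𝒜.contMDiff_anchor.comp X.contMDiff)⟩)
    (fun X Y f => by
      ext q
      exact (congrArg (d I f q) (map_add (𝒜.anchor q) (X q) (Y q))).trans (map_add _ _ _))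
    (fun c X f => by
      ext q
      exact (congrArg (d I f q) (map_smul (𝒜.anchor q) c (X q))).trans (map_smul _ _ _))
    (fun X f g => by
      ext q
      exact congrArg (fun α : Cotangent I q => α (𝒜.anchor q (X q)))
        (d_add (mdifferentiableAt_map f q) (mdifferentiableAt_map g q)))
    (fun c X f => by
      ext q
      exact congrArg (fun α : Cotangent I q => α (𝒜.anchor q (X q)))
        (d_const_smul (mdifferentiableAt_map f q) c))

theorem anchorDer_apply (X : Cₛ^∞⟮I; F, A⟯) (f : C^∞⟮I, Q; ℝ⟯) (q : Q) :
    𝒜.anchorDer X f q = d I f q (𝒜.anchor q (X q)) := rfl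

theorem bracket_skew (X Y : Cₛ^∞⟮I; F, A⟯) : 𝒜.bracket X Y = -𝒜.bracket Y X := by
  have h := 𝒜.bracket_self (X + Y)
  simp only [map_add, LinearMap.add_apply, 𝒜.bracket_self, zero_add, add_zero] at h
  exact eq_neg_of_add_eq_zero_right h

theorem bracket_fsmul (X Y : Cₛ^∞⟮I; F, A⟯) (f : C^∞⟮I, Q; ℝ⟯) :
    𝒜.bracket X (fsmul f Y) = fsmul f (𝒜.bracket X Y) + fsmul (𝒜.anchorDer X f) Y := by
  ext q
  exact 𝒜.leibniz X Y f q

/-- The anchor is a homomorphism of brackets. -/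
theorem anchorDer_bracket (X Y : Cₛ^∞⟮I; F, A⟯) (f : C^∞⟮I, Q; ℝ⟯) :
    𝒜.anchorDer (𝒜.bracket X Y) f
      = 𝒜.anchorDer X (𝒜.anchorDer Y f) - 𝒜.anchorDer Y (𝒜.anchorDer X f) := by
  ext q
  rw [ContMDiffMap.coe_sub, Pi.sub_apply]
  by_cases hZ : ∃ Z : Cₛ^∞⟮I; F, A⟯, Z q ≠ 0
  · obtain ⟨Z, hZ⟩ := hZ
    have h := 𝒜.jacobi X Y (fsmul f Z)
    have h' := 𝒜.jacobi X Y Z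
    rw [𝒜.bracket_skew (fsmul f Z) X, 𝒜.bracket_skew (fsmul f Z)] at h
    rw [𝒜.bracket_skew Z X, 𝒜.bracket_skew Z] at h'
    simp only [map_neg, bracket_fsmul, map_add] at h
    rw [map_neg] at h'
    have e := congrArg (fun W : Cₛ^∞⟮I; F, A⟯ => W q) h
    have e' := congrArg (fun W : Cₛ^∞⟮I; F, A⟯ => W q) h'
    simp only [ContMDiffSection.coe_add, ContMDiffSection.coe_neg, ContMDiffSection.coe_zero,
      Pi.add_apply, Pi.neg_apply, Pi.zero_apply] at e e'
    have hs (g : C^∞⟮I, Q; ℝ⟯) (W : Cₛ^∞⟮I; F, A⟯) : fsmul g W q = g q • W q := rfl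
    simp only [hs] at e
    have key : (𝒜.anchorDer (𝒜.bracket X Y) f q - (𝒜.anchorDer X (𝒜.anchorDer Y f) q
        - 𝒜.anchorDer Y (𝒜.anchorDer X f) q)) • Z q = 0 := by
      have e'' := congrArg (fun w => f q • w) e'
      simp only [smul_add, smul_neg, smul_zero] at e''
      rw [← sub_eq_zero.2 (e''.trans e.symm)]
      module
    exact sub_eq_zero.1 ((smul_eq_zero.1 key).resolve_right hZ)
  · push Not at hZ
    simp [anchorDer_apply, hZ]

/-- The bracket of pairs `(X, f)` of a section and a function, which corresponds to the Poisson
bracket of the functions `X^ + f ∘ π`. -/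
def pairBracket : Cₛ^∞⟮I; F, A⟯ × C^∞⟮I, Q; ℝ⟯ →ₗ[ℝ] Cₛ^∞⟮I; F, A⟯ × C^∞⟮I, Q; ℝ⟯ →ₗ[ℝ]
    Cₛ^∞⟮I; F, A⟯ × C^∞⟮I, Q; ℝ⟯ :=
  LinearMap.mk₂ ℝ
    (fun s t => (𝒜.bracket s.1 t.1, 𝒜.anchorDer s.1 t.2 - 𝒜.anchorDer t.1 s.2))
    (fun s s' t => by ext1 <;> simp; abel)
    (fun c s t => by ext1 <;> simp [smul_sub])
    (fun s t t' => by ext1 <;> simp; abel)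
    (fun c s t => by ext1 <;> simp [smul_sub])

theorem pairBracket_apply (s t : Cₛ^∞⟮I; F, A⟯ × C^∞⟮I, Q; ℝ⟯) :
    𝒜.pairBracket s t = (𝒜.bracket s.1 t.1, 𝒜.anchorDer s.1 t.2 - 𝒜.anchorDer t.1 s.2) := rfl

theorem pairBracket_skew (s t : Cₛ^∞⟮I; F, A⟯ × C^∞⟮I, Q; ℝ⟯) :
    𝒜.pairBracket s t = -𝒜.pairBracket t s := by
  ext1 <;> simp [pairBracket_apply, 𝒜.bracket_skew s.1]

theorem pairBracket_jacobi (s t u : Cₛ^∞⟮I; F, A⟯ × C^∞⟮I, Q; ℝ⟯) :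
    𝒜.pairBracket (𝒜.pairBracket s t) u + 𝒜.pairBracket (𝒜.pairBracket t u) s
      + 𝒜.pairBracket (𝒜.pairBracket u s) t = 0 := by
  ext1
  · simp only [pairBracket_apply, Prod.fst_add, Prod.fst_zero]
    have h := 𝒜.jacobi s.1 t.1 u.1
    rw [𝒜.bracket_skew (𝒜.bracket s.1 t.1), 𝒜.bracket_skew (𝒜.bracket t.1 u.1),
      𝒜.bracket_skew (𝒜.bracket u.1 s.1), ← neg_eq_zero, ← h]
    abel
  · simp only [pairBracket_apply, Prod.snd_add, Prod.snd_zero, anchorDer_bracket, map_sub]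
    abel

/-- The projection `(X, f) ↦ (X, 0)`, which corresponds to the Liouville vector field. -/
def sectionPart : Cₛ^∞⟮I; F, A⟯ × C^∞⟮I, Q; ℝ⟯ →ₗ[ℝ] Cₛ^∞⟮I; F, A⟯ × C^∞⟮I, Q; ℝ⟯ :=
  LinearMap.inl ℝ _ _ ∘ₗ LinearMap.fst ℝ _ _

theorem sectionPart_pairBracket (s t : Cₛ^∞⟮I; F, A⟯ × C^∞⟮I, Q; ℝ⟯) :
    sectionPart (𝒜.pairBracket s t)
      = 𝒜.pairBracket (sectionPart s) t + 𝒜.pairBracket s (sectionPart t)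
        - 𝒜.pairBracket s t := by
  ext1 <;> simp [pairBracket_apply, sectionPart]

end LieAlgebroid

end Observables

section Charts

variable {E : Type*} [NormedAddCommGroup E] [NormedSpace ℝ E]
  {H : Type*} [TopologicalSpace H] {I : ModelWithCorners ℝ E H}
  {M : Type*} [TopologicalSpace M] [ChartedSpace H M]

theorem chartCovector_self [IsManifold I ∞ M] (x : M) (α : Cotangent I x) :
    chartCovector I x α x = α := by
  have : IsManifold I 1 M := IsManifold.of_le (n := ∞) (by simp)
  unfold chartCovector
  rw [mfderiv_extChartAt_self]
  rfl

theorem d_comp_extChartAt [IsManifold I ∞ M] {x₀ x : M} (hx : x ∈ (chartAt H x₀).source)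
    (α : E →L[ℝ] ℝ) : d I (fun y => α (extChartAt I x₀ y)) x = chartCovector I x₀ α x := by
  have : IsManifold I 1 M := IsManifold.of_le (n := ∞) (by simp)
  exact (α.hasMFDerivAt.comp x (mdifferentiableAt_extChartAt hx).hasMFDerivAt).mfderiv

end Charts

section DualBundle

variable {E : Type*} [NormedAddCommGroup E] [NormedSpace ℝ E]
  {H : Type*} [TopologicalSpace H] {I : ModelWithCorners ℝ E H}
  {Q : Type*} [TopologicalSpace Q] [ChartedSpace H Q]
  {F : Type*} [NormedAddCommGroup F] [NormedSpace ℝ F]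
  {A : Q → Type*} [TopologicalSpace (TotalSpace F A)]
  [∀ q, AddCommGroup (A q)] [∀ q, Module ℝ (A q)] [∀ q, TopologicalSpace (A q)]
  [FiberBundle F A] [VectorBundle ℝ F A]

theorem dual_extChartAt_fst (μ₀ μ : DualTotal F A) :
    (extChartAt (dualModel I F) μ₀ μ).1 = extChartAt I μ₀.1 μ.1 := by
  rw [FiberBundle.extChartAt]
  rfl

theorem dual_extChartAt_snd {μ₀ μ : DualTotal F A}
    (h : μ.1 ∈ (trivializationAt F A μ₀.1).baseSet) (v : F) :
    (extChartAt (dualModel I F) μ₀ μ).2 v = μ.2 ((trivializationAt F A μ₀.1).symm μ.1 v) := by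
  rw [FiberBundle.extChartAt]
  change (trivializationAt (F →L[ℝ] ℝ) (Dual A) μ₀.1 μ).2 v = _
  rw [hom_trivializationAt_apply]
  change ContinuousLinearMap.inCoordinates F A ℝ (Bundle.Trivial Q ℝ) μ₀.1 μ.1 μ₀.1 μ.1 μ.2 v = _
  rw [ContinuousLinearMap.inCoordinates_eq h (by simp)]
  simp

theorem mem_dual_chartAt_source {μ₀ μ : DualTotal F A} :
    μ ∈ (chartAt (ModelProd H (F →L[ℝ] ℝ)) μ₀).source ↔
      μ.1 ∈ (chartAt H μ₀.1).source ∧ μ.1 ∈ (trivializationAt F A μ₀.1).baseSet := by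
  rw [FiberBundle.chartedSpace_chartAt]
  rw [OpenPartialHomeomorph.trans_source]
  simp only [OpenPartialHomeomorph.prod_source, Trivialization.coe_coe, Set.mem_inter_iff,
    Set.mem_preimage, Set.mem_prod, OpenPartialHomeomorph.refl_source, Set.mem_univ, and_true]
  rw [Trivialization.source_eq, hom_trivializationAt_baseSet]
  simp only [Set.mem_preimage, Set.mem_inter_iff]
  constructor
  · rintro ⟨⟨h1, -⟩, h2⟩
    exact ⟨h2, h1⟩
  · rintro ⟨h1, h2⟩
    exact ⟨⟨h2, Set.mem_univ _⟩, h1⟩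

theorem continuous_dual_proj : Continuous (fun μ : DualTotal F A => μ.1) :=
  FiberBundle.continuous_proj (F →L[ℝ] ℝ) (Dual A)

theorem hat_eventuallyEq {μ₀ μ : DualTotal F A}
    (h : μ.1 ∈ (trivializationAt F A μ₀.1).baseSet) {X : Cₛ^∞⟮I; F, A⟯} {v : F}
    (hX : ∀ᶠ q in 𝓝 μ.1, X q = (trivializationAt F A μ₀.1).symm q v) :
    hat X =ᶠ[𝓝 μ] fun ν => (extChartAt (dualModel I F) μ₀ ν).2 v := by
  filter_upwards [continuous_dual_proj.continuousAt.eventually hX,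
    continuous_dual_proj.continuousAt.eventually
      ((trivializationAt F A μ₀.1).open_baseSet.mem_nhds h)] with ν h1 h2
  rw [dual_extChartAt_snd h2, ← h1]
  rfl

theorem contMDiff_hat [ContMDiffVectorBundle ∞ F A I] (X : Cₛ^∞⟮I; F, A⟯) :
    ContMDiff (dualModel I F) 𝓘(ℝ, ℝ) ∞ (hat (F := F) X) := by
  have h := ContMDiff.clm_bundle_apply (IB := I) (IM := dualModel I F) (n := ∞) (F₁ := F) (F₂ := ℝ)
    (E₁ := A) (E₂ := Bundle.Trivial Q ℝ)
    (b := fun μ : DualTotal F A => μ.1) (v := fun μ => X μ.1) (ϕ := fun μ => μ.2)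
    contMDiff_id (X.contMDiff.comp (contMDiff_proj (Dual A)))
  intro μ
  exact (contMDiffAt_totalSpace.1 (h μ)).2

theorem mfderiv_dual_proj [IsManifold I ∞ Q] [ContMDiffVectorBundle ∞ F A I]
    (μ : DualTotal F A) :
    mfderiv (dualModel I F) I (fun ν : DualTotal F A => ν.1) μ
      = ContinuousLinearMap.fst ℝ E (F →L[ℝ] ℝ) := by
  have hπ : MDifferentiableAt (dualModel I F) I (fun ν : DualTotal F A => ν.1) μ :=
    (contMDiff_proj (n := 1) (Dual A)).mdifferentiable one_ne_zero μ
  have : IsManifold I 1 Q := IsManifold.of_le (n := ∞) (by simp)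
  have : IsManifold (dualModel I F) 1 (DualTotal F A) := IsManifold.of_le (n := ∞) (by simp)
  have h1 := (mdifferentiableAt_extChartAt (I := I)
    (mem_chart_source H μ.1)).hasMFDerivAt.comp μ hπ.hasMFDerivAt
  have h2 := (ContinuousLinearMap.fst ℝ E (F →L[ℝ] ℝ)).hasMFDerivAt.comp μ
    (mdifferentiableAt_extChartAt (I := dualModel I F) (mem_chart_source _ μ)).hasMFDerivAt
  rw [mfderiv_extChartAt_self] at h1 h2
  have h3 : (extChartAt I μ.1 ∘ fun ν : DualTotal F A => ν.1)
      = (ContinuousLinearMap.fst ℝ E (F →L[ℝ] ℝ)) ∘ extChartAt (dualModel I F) μ := by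
    ext ν
    exact (dual_extChartAt_fst μ ν).symm
  rw [h3] at h1
  exact (hasMFDerivAt_unique (I' := 𝓘(ℝ, E)) h1 h2)

theorem d_base_apply [IsManifold I ∞ Q] [ContMDiffVectorBundle ∞ F A I]
    (f : C^∞⟮I, Q; ℝ⟯) (μ : DualTotal F A) (w : E) (ξ : F →L[ℝ] ℝ) :
    d (dualModel I F) (fun ν : DualTotal F A => f ν.1) μ (w, ξ) = d I f μ.1 w := by
  have hπ : MDifferentiableAt (dualModel I F) I (fun ν : DualTotal F A => ν.1) μ :=
    (contMDiff_proj (n := 1) (Dual A)).mdifferentiable one_ne_zero μ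
  have h := ((mdifferentiableAt_map f μ.1).hasMFDerivAt.comp μ hπ.hasMFDerivAt).mfderiv
  rw [mfderiv_dual_proj] at h
  exact congrArg (fun α : (E × (F →L[ℝ] ℝ)) →L[ℝ] ℝ => α (w, ξ)) h

theorem d_hat_apply [IsManifold I ∞ Q] [ContMDiffVectorBundle ∞ F A I]
    {X : Cₛ^∞⟮I; F, A⟯} {μ : DualTotal F A} {v : F}
    (hX : ∀ᶠ q in 𝓝 μ.1, X q = (trivializationAt F A μ.1).symm q v) (w : E) (ξ : F →L[ℝ] ℝ) :
    d (dualModel I F) (hat X) μ (w, ξ) = ξ v := by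
  rw [d_congr (hat_eventuallyEq (mem_baseSet_trivializationAt F A μ.1) hX)]
  have h := d_comp_extChartAt (mem_chart_source (ModelProd H (F →L[ℝ] ℝ)) μ)
    ((ContinuousLinearMap.apply ℝ ℝ v).comp (ContinuousLinearMap.snd ℝ E (F →L[ℝ] ℝ)))
    (I := dualModel I F)
  exact congrArg (fun α : (E × (F →L[ℝ] ℝ)) →L[ℝ] ℝ => α (w, ξ)) (h.trans (chartCovector_self _ _))

/-- The function `X^ + f ∘ π` on `A*`. -/
def obs : Cₛ^∞⟮I; F, A⟯ × C^∞⟮I, Q; ℝ⟯ →ₗ[ℝ] (DualTotal F A → ℝ) where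
  toFun s μ := hat s.1 μ + s.2 μ.1
  map_add' s t := by
    ext μ
    have h : hat (s.1 + t.1) μ = hat s.1 μ + hat t.1 μ := map_add μ.2 _ _
    have h' : (s.2 + t.2) μ.1 = s.2 μ.1 + t.2 μ.1 := rfl
    simp only [Prod.fst_add, Prod.snd_add, Pi.add_apply, h, h']
    ring
  map_smul' c s := by
    ext μ
    have h : hat (c • s.1) μ = c * hat s.1 μ := map_smul μ.2 _ _
    have h' : (c • s.2) μ.1 = c * s.2 μ.1 := rfl
    simp only [Prod.smul_fst, Prod.smul_snd, Pi.smul_apply, h, h', RingHom.id_apply, smul_eq_mul]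
    ring

theorem obs_apply (s : Cₛ^∞⟮I; F, A⟯ × C^∞⟮I, Q; ℝ⟯) (μ : DualTotal F A) :
    obs s μ = hat s.1 μ + s.2 μ.1 := rfl

theorem contMDiff_base (f : C^∞⟮I, Q; ℝ⟯) :
    ContMDiff (dualModel I F) 𝓘(ℝ, ℝ) ∞ fun μ : DualTotal F A => f μ.1 :=
  f.contMDiff.comp (contMDiff_proj (Dual A))

theorem contMDiff_obs [ContMDiffVectorBundle ∞ F A I]
    (s : Cₛ^∞⟮I; F, A⟯ × C^∞⟮I, Q; ℝ⟯) : ContMDiff (dualModel I F) 𝓘(ℝ, ℝ) ∞ (obs s) :=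
  (contMDiff_hat s.1).add (contMDiff_base s.2)

theorem mdifferentiableAt_obs [ContMDiffVectorBundle ∞ F A I]
    (s : Cₛ^∞⟮I; F, A⟯ × C^∞⟮I, Q; ℝ⟯) (μ : DualTotal F A) :
    MDifferentiableAt (dualModel I F) 𝓘(ℝ, ℝ) (obs s) μ :=
  (contMDiff_obs s).mdifferentiable (by simp) μ

theorem d_obs [ContMDiffVectorBundle ∞ F A I]
    (s : Cₛ^∞⟮I; F, A⟯ × C^∞⟮I, Q; ℝ⟯) (μ : DualTotal F A) :
    d (dualModel I F) (obs s) μ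
      = d (dualModel I F) (hat s.1) μ + d (dualModel I F) (fun ν : DualTotal F A => s.2 ν.1) μ :=
  d_add ((contMDiff_hat s.1).mdifferentiable (by simp) μ)
    ((contMDiff_base s.2).mdifferentiable (by simp) μ)

/-- The differential at `μ` of the functions `X^ + f ∘ π`. -/
def dObs [ContMDiffVectorBundle ∞ F A I] (μ : DualTotal F A) :
    Cₛ^∞⟮I; F, A⟯ × C^∞⟮I, Q; ℝ⟯ →ₗ[ℝ] Cotangent (dualModel I F) μ where
  toFun s := d (dualModel I F) (obs s) μ
  map_add' s t := by
    rw [map_add]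
    exact d_add (mdifferentiableAt_obs s μ) (mdifferentiableAt_obs t μ)
  map_smul' c s := by
    rw [map_smul]
    exact d_const_smul (mdifferentiableAt_obs s μ) c

theorem dObs_apply [ContMDiffVectorBundle ∞ F A I] (μ : DualTotal F A)
    (s : Cₛ^∞⟮I; F, A⟯ × C^∞⟮I, Q; ℝ⟯) : dObs μ s = d (dualModel I F) (obs s) μ := rfl

theorem dObs_section [ContMDiffVectorBundle ∞ F A I] (X : Cₛ^∞⟮I; F, A⟯) (μ : DualTotal F A) :
    dObs μ (X, 0) = d (dualModel I F) (hat X) μ := by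
  rw [dObs_apply]
  congr 1
  ext ν
  exact add_zero _

theorem dObs_function [ContMDiffVectorBundle ∞ F A I] (f : C^∞⟮I, Q; ℝ⟯)
    (μ : DualTotal F A) :
    dObs (A := A) μ (0, f) = d (dualModel I F) (fun ν : DualTotal F A => f ν.1) μ := by
  rw [dObs_apply]
  congr 1
  ext ν
  have h : hat (0 : Cₛ^∞⟮I; F, A⟯) ν = 0 := map_zero ν.2
  rw [obs_apply, h, zero_add]

end DualBundle

section Coordinates

theorem exists_eq_apply {F : Type*} [NormedAddCommGroup F] [NormedSpace ℝ F]
    [FiniteDimensional ℝ F] (α : (F →L[ℝ] ℝ) →L[ℝ] ℝ) : ∃ v : F, ∀ ξ, α ξ = ξ v := by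
  obtain ⟨v, hv⟩ := (Module.evalEquiv ℝ F).surjective
    (α.toLinearMap ∘ₗ (LinearMap.toContinuousLinearMap (𝕜 := ℝ) (E := F) (F' := ℝ)).toLinearMap)
  refine ⟨v, fun ξ => ?_⟩
  have h := congrArg (fun β : Module.Dual ℝ (Module.Dual ℝ F) => β ξ.toLinearMap) hv
  exact h.symm

variable {E : Type*} [NormedAddCommGroup E] [NormedSpace ℝ E] [FiniteDimensional ℝ E]
  {H : Type*} [TopologicalSpace H] {I : ModelWithCorners ℝ E H}
  {Q : Type*} [TopologicalSpace Q] [T2Space Q] [ChartedSpace H Q] [IsManifold I ∞ Q]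
  {F : Type*} [NormedAddCommGroup F] [NormedSpace ℝ F] [FiniteDimensional ℝ F]
  {A : Q → Type*} [TopologicalSpace (TotalSpace F A)]
  [∀ q, AddCommGroup (A q)] [∀ q, Module ℝ (A q)] [∀ q, TopologicalSpace (A q)]
  [FiberBundle F A] [VectorBundle ℝ F A]
  [ContMDiffVectorBundle ∞ F A I]

/-- A linear function of the coordinates of `A*` is locally of the form `X^ + f ∘ π`. -/
theorem exists_obs_eventuallyEq {μ₀ μ : DualTotal F A}
    (h : μ ∈ (chartAt (ModelProd H (F →L[ℝ] ℝ)) μ₀).source) (α : (E × (F →L[ℝ] ℝ)) →L[ℝ] ℝ) :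
    ∃ s : Cₛ^∞⟮I; F, A⟯ × C^∞⟮I, Q; ℝ⟯,
      obs s =ᶠ[𝓝 μ] fun ν => α (extChartAt (dualModel I F) μ₀ ν) := by
  obtain ⟨h1, h2⟩ := mem_dual_chartAt_source.1 h
  obtain ⟨v, hv⟩ := exists_eq_apply (α.comp (ContinuousLinearMap.inr ℝ E (F →L[ℝ] ℝ)))
  obtain ⟨X, hX⟩ := exists_section_eventuallyEq_symm (I := I) h2 v
  obtain ⟨f, hf⟩ := exists_contMDiffMap_eventuallyEq (chartAt H μ₀.1).open_source h1
    ((α.comp (ContinuousLinearMap.inl ℝ E (F →L[ℝ] ℝ))).contMDiff.comp_contMDiffOn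
      (contMDiffOn_extChartAt (I := I) (n := ∞)))
  refine ⟨(X, f), ?_⟩
  filter_upwards [hat_eventuallyEq h2 hX, continuous_dual_proj.continuousAt.eventually hf]
    with ν hν hν'
  have h3 : α (extChartAt (dualModel I F) μ₀ ν)
      = α ((extChartAt (dualModel I F) μ₀ ν).1, 0)
        + α (0, (extChartAt (dualModel I F) μ₀ ν).2) := by
    rw [← map_add]
    simp
  have h4 : α (0, (extChartAt (dualModel I F) μ₀ ν).2) = _ := hv _
  rw [obs_apply, hν, h3, h4, dual_extChartAt_fst, add_comm]
  exact congrArg (· + _) hν'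

theorem exists_chartCovector_eq {μ₀ μ : DualTotal F A}
    (h : μ ∈ (chartAt (ModelProd H (F →L[ℝ] ℝ)) μ₀).source)
    (α : Cotangent (dualModel I F) μ₀) :
    ∃ s : Cₛ^∞⟮I; F, A⟯ × C^∞⟮I, Q; ℝ⟯,
      ∀ᶠ ν in 𝓝 μ, chartCovector (dualModel I F) μ₀ α ν = dObs ν s := by
  obtain ⟨s, hs⟩ := exists_obs_eventuallyEq (I := I) h α
  refine ⟨s, ?_⟩
  filter_upwards [hs.eventually_nhds, (chartAt _ μ₀).open_source.mem_nhds h] with ν hν hν'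
  exact ((d_congr hν).trans (d_comp_extChartAt hν' _)).symm

theorem dObs_surjective (μ : DualTotal F A) : Function.Surjective (dObs (I := I) μ) := by
  intro α
  obtain ⟨s, hs⟩ := exists_chartCovector_eq (mem_chart_source _ μ) α
  exact ⟨s, by rw [← hs.self_of_nhds, chartCovector_self]⟩

/-- A linear choice of functions `X^ + f ∘ π` with given differentials at `μ`. -/
def dObsRightInverse (μ : DualTotal F A) :
    Cotangent (dualModel I F) μ →ₗ[ℝ] Cₛ^∞⟮I; F, A⟯ × C^∞⟮I, Q; ℝ⟯ :=
  ((dObs (I := I) μ).exists_rightInverse_of_surjective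
    (LinearMap.range_eq_top.2 (dObs_surjective μ))).choose

theorem dObs_dObsRightInverse (μ : DualTotal F A) (α : Cotangent (dualModel I F) μ) :
    dObs μ (dObsRightInverse μ α) = α :=
  LinearMap.congr_fun ((dObs (I := I) μ).exists_rightInverse_of_surjective
    (LinearMap.range_eq_top.2 (dObs_surjective μ))).choose_spec α

end Coordinates

section SchoutenBracket

variable {E : Type*} [NormedAddCommGroup E] [NormedSpace ℝ E]
  {H : Type*} [TopologicalSpace H] {I : ModelWithCorners ℝ E H}
  {M : Type*} [TopologicalSpace M] [ChartedSpace H M]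

theorem bivComp_eventuallyEq {Λ : BilinField I M} {x₀ x : M} {α β : Cotangent I x₀}
    {f g h : M → ℝ}
    (hα : ∀ᶠ y in 𝓝 x, chartCovector I x₀ α y = d I f y)
    (hβ : ∀ᶠ y in 𝓝 x, chartCovector I x₀ β y = d I g y)
    (hfg : ∀ y, Λ y (d I f y) (d I g y) = h y) :
    bivComp I Λ x₀ α β =ᶠ[𝓝 x] h := by
  filter_upwards [hα, hβ] with y h1 h2
  rw [bivComp, h1, h2, hfg]

theorem schouten_self_eq [IsManifold I ∞ M] {Λ : BilinField I M} {x : M} {α β γ : Cotangent I x}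
    {f g h fg gh hf : M → ℝ}
    (hα : ∀ᶠ y in 𝓝 x, chartCovector I x α y = d I f y)
    (hβ : ∀ᶠ y in 𝓝 x, chartCovector I x β y = d I g y)
    (hγ : ∀ᶠ y in 𝓝 x, chartCovector I x γ y = d I h y)
    (hfg : ∀ y, Λ y (d I f y) (d I g y) = fg y)
    (hgh : ∀ y, Λ y (d I g y) (d I h y) = gh y)
    (hhf : ∀ y, Λ y (d I h y) (d I f y) = hf y) :
    schouten I Λ Λ x α β γ
      = 2 * (Λ x (d I fg x) (d I h x) + Λ x (d I gh x) (d I f x) + Λ x (d I hf x) (d I g x)) := by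
  have eα := (chartCovector_self x α).symm.trans hα.self_of_nhds
  have eβ := (chartCovector_self x β).symm.trans hβ.self_of_nhds
  have eγ := (chartCovector_self x γ).symm.trans hγ.self_of_nhds
  rw [schouten, d_congr (bivComp_eventuallyEq hα hβ hfg), d_congr (bivComp_eventuallyEq hβ hγ hgh),
    d_congr (bivComp_eventuallyEq hγ hα hhf), eα, eβ, eγ]
  ring

end SchoutenBracket

section Associated

variable {E : Type*} [NormedAddCommGroup E] [NormedSpace ℝ E]
  {H : Type*} [TopologicalSpace H] {I : ModelWithCorners ℝ E H}
  {Q : Type*} [TopologicalSpace Q] [ChartedSpace H Q] [IsManifold I ∞ Q]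
  {F : Type*} [NormedAddCommGroup F] [NormedSpace ℝ F]
  {A : Q → Type*} [TopologicalSpace (TotalSpace F A)]
  [∀ q, AddCommGroup (A q)] [∀ q, Module ℝ (A q)] [∀ q, TopologicalSpace (A q)]
  [FiberBundle F A] [VectorBundle ℝ F A] [ContMDiffVectorBundle ∞ F A I]

theorem IsAssociated.apply_dObs {𝒜 : LieAlgebroid I F A}
    {Λ : BilinField (dualModel I F) (DualTotal F A)} (h : IsAssociated I F A 𝒜 Λ)
    (μ : DualTotal F A) (s t : Cₛ^∞⟮I; F, A⟯ × C^∞⟮I, Q; ℝ⟯) :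
    Λ μ (dObs μ s) (dObs μ t) = obs (𝒜.pairBracket s t) μ := by
  have h1 : d (dualModel I F) (fun ν : DualTotal F A => s.2 ν.1) μ = dObs μ (0, s.2) :=
    (dObs_function s.2 μ).symm
  rw [dObs_apply, dObs_apply, d_obs, d_obs, map_add, map_add, LinearMap.add_apply,
    LinearMap.add_apply, h.hat_hat, h.hat_base, h.base_base,
    ← (h.isBivectorField.alt μ).neg_eq (d (dualModel I F) (hat t.1) μ), h.hat_base, obs_apply]
  simp only [LieAlgebroid.pairBracket_apply]
  change _ = _ + (d I t.2 μ.1 (𝒜.anchor μ.1 (s.1 μ.1)) - d I s.2 μ.1 (𝒜.anchor μ.1 (t.1 μ.1)))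
  ring

end Associated

section LinearPoisson

variable {E : Type*} [NormedAddCommGroup E] [NormedSpace ℝ E] [FiniteDimensional ℝ E]
  {H : Type*} [TopologicalSpace H] {I : ModelWithCorners ℝ E H}
  {Q : Type*} [TopologicalSpace Q] [T2Space Q] [ChartedSpace H Q] [IsManifold I ∞ Q]
  {F : Type*} [NormedAddCommGroup F] [NormedSpace ℝ F]
  {A : Q → Type*} [TopologicalSpace (TotalSpace F A)]
  [∀ q, AddCommGroup (A q)] [∀ q, Module ℝ (A q)] [∀ q, TopologicalSpace (A q)]
  [FiberBundle F A] [VectorBundle ℝ F A]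

namespace LieAlgebroid

variable (𝒜 : LieAlgebroid I F A)

theorem bracket_eq_zero_of_eventuallyEq_zero (Y : Cₛ^∞⟮I; F, A⟯) {X : Cₛ^∞⟮I; F, A⟯} {q : Q}
    (hX : ∀ᶠ x in 𝓝 q, X x = 0) : 𝒜.bracket Y X q = 0 := by
  obtain ⟨χ, h1, h2⟩ := exists_bump (I := I) hX
  have h3 : X = fsmul (1 - χ) X := by
    ext x
    change X x = (1 - χ x) • X x
    by_cases hx : x ∈ tsupport χ
    · rw [show X x = 0 from h2 hx, smul_zero]
    · simp [image_eq_zero_of_notMem_tsupport hx]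
  have h4 : (1 - χ) q = 0 := by
    change 1 - χ q = 0
    rw [h1.self_of_nhds]
    simp
  rw [h3, 𝒜.leibniz, h4, hX.self_of_nhds, zero_smul, smul_zero, add_zero]

theorem bracket_congr (Y : Cₛ^∞⟮I; F, A⟯) {X X' : Cₛ^∞⟮I; F, A⟯} {q : Q}
    (hX : ∀ᶠ x in 𝓝 q, X x = X' x) : 𝒜.bracket Y X q = 𝒜.bracket Y X' q := by
  have h := 𝒜.bracket_eq_zero_of_eventuallyEq_zero Y (X := X - X')
    (hX.mono fun x hx => sub_eq_zero.2 hx)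
  rw [map_sub] at h
  exact sub_eq_zero.1 h

variable [FiniteDimensional ℝ F] [ContMDiffVectorBundle ∞ F A I]

/-- The bracket of observables depends only on their differentials. -/
theorem obs_pairBracket_eq_zero {μ : DualTotal F A} {s : Cₛ^∞⟮I; F, A⟯ × C^∞⟮I, Q; ℝ⟯}
    (hs : dObs μ s = 0) (t : Cₛ^∞⟮I; F, A⟯ × C^∞⟮I, Q; ℝ⟯) :
    obs (𝒜.pairBracket s t) μ = 0 := by
  obtain ⟨X, f⟩ := s
  obtain ⟨Y, g⟩ := t
  let b := Module.finBasis ℝ F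
  choose Z hZ using fun i => exists_section_eventuallyEq_symm (I := I)
    (mem_baseSet_trivializationAt F A μ.1) (b i)
  obtain ⟨c, hc⟩ := exists_coeff_eventuallyEq_sum b μ.1 X Z hZ
  set X' := ∑ i, fsmul (c i) (Z i) with hX'
  have hval (W : Fin (Module.finrank ℝ F) → Cₛ^∞⟮I; F, A⟯) (q : Q) :
      (∑ i, W i) q = ∑ i, W i q := by
    rw [← ContMDiffSection.coeAddHom_apply, map_sum, Finset.sum_apply]
    rfl
  have hdiff : ∀ (w : TangentSpace I μ.1) (ξ : F →L[ℝ] ℝ),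
      ∑ i, (c i μ.1 * ξ (b i) + hat (Z i) μ * d I (c i) μ.1 w) + d I f μ.1 w = 0 := by
    intro w ξ
    have h1 : hat X =ᶠ[𝓝 μ] ∑ i, fun ν : DualTotal F A => c i ν.1 * hat (Z i) ν := by
      filter_upwards [continuous_dual_proj.continuousAt.eventually hc] with ν hν
      rw [hat, hν, hX', hval, map_sum, Finset.sum_apply]
      exact Finset.sum_congr rfl fun i _ => map_smul ν.2 _ _
    have h2 (i) : HasMFDerivAt (dualModel I F) 𝓘(ℝ, ℝ)
        (fun ν : DualTotal F A => c i ν.1 * hat (Z i) ν) μ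
        (c i μ.1 • d (dualModel I F) (hat (Z i)) μ
          + hat (Z i) μ • d (dualModel I F) (fun ν : DualTotal F A => c i ν.1) μ) :=
      ((contMDiff_base (c i)).mdifferentiable (by simp) μ).hasMFDerivAt.mul
        ((contMDiff_hat (Z i)).mdifferentiable (by simp) μ).hasMFDerivAt
    have h3 := (HasMFDerivAt.sum (t := Finset.univ) fun i _ => h2 i).mfderiv
    rw [dObs_apply, d_obs, d_congr h1, d, h3] at hs
    have h4 := congrArg (fun α : (E × (F →L[ℝ] ℝ)) →L[ℝ] ℝ => α (w, ξ)) hs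
    refine Eq.trans ?_ h4
    refine congrArg₂ (· + ·) ?_ (d_base_apply f μ w ξ).symm
    refine Eq.trans ?_ (sum_apply (F := (E × (F →L[ℝ] ℝ)) →L[ℝ] ℝ) _ _ (w, ξ)).symm
    refine Finset.sum_congr rfl fun i _ => ?_
    exact congrArg₂ (fun x y => c i μ.1 * x + hat (Z i) μ * y) (d_hat_apply (hZ i) w ξ).symm
      (d_base_apply (c i) μ w ξ).symm
  have hc0 (i) : c i μ.1 = 0 := by
    have h := hdiff 0 (LinearMap.toContinuousLinearMap (b.coord i))
    simp only [map_zero, mul_zero, add_zero] at h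
    simpa [Finsupp.single_apply] using h
  have hX0 : X μ.1 = 0 := by
    rw [hc.self_of_nhds, hX', hval]
    exact Finset.sum_eq_zero fun i _ => by
      change c i μ.1 • Z i μ.1 = 0
      rw [hc0, zero_smul]
  have h5 : hat (𝒜.bracket X Y) μ = d I f μ.1 (𝒜.anchor μ.1 (Y μ.1)) := by
    have h6 : 𝒜.bracket Y X μ.1 = ∑ i, d I (c i) μ.1 (𝒜.anchor μ.1 (Y μ.1)) • Z i μ.1 := by
      rw [𝒜.bracket_congr Y hc, hX', map_sum, hval]
      refine Finset.sum_congr rfl fun i _ => ?_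
      rw [𝒜.leibniz, hc0, zero_smul, zero_add]
    have h7 := hdiff (𝒜.anchor μ.1 (Y μ.1)) 0
    rw [𝒜.bracket_skew]
    change μ.2 (-(𝒜.bracket Y X μ.1)) = _
    rw [map_neg, h6, map_sum, neg_eq_iff_add_eq_zero, ← h7]
    congr 1
    refine Finset.sum_congr rfl fun i _ => ?_
    rw [map_smul]
    simp [hat, mul_comm]
  rw [pairBracket_apply, obs_apply, h5]
  change _ + (d I g μ.1 (𝒜.anchor μ.1 (X μ.1)) - d I f μ.1 (𝒜.anchor μ.1 (Y μ.1))) = 0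
  rw [hX0, map_zero, map_zero]
  ring

/-- The bivector field on `A*` that corresponds to a Lie algebroid structure on `A`. -/
def dualBivector : BilinField (dualModel I F) (DualTotal F A) := fun μ =>
  (𝒜.pairBracket.compr₂ (LinearMap.proj μ ∘ₗ obs)).compl₁₂ (dObsRightInverse μ)
    (dObsRightInverse μ)

theorem dualBivector_dObs (μ : DualTotal F A) (s t : Cₛ^∞⟮I; F, A⟯ × C^∞⟮I, Q; ℝ⟯) :
    𝒜.dualBivector μ (dObs μ s) (dObs μ t) = obs (𝒜.pairBracket s t) μ := by
  change obs (𝒜.pairBracket (dObsRightInverse μ (dObs μ s)) (dObsRightInverse μ (dObs μ t))) μ = _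
  set r := dObsRightInverse (I := I) μ
  have h (u : Cₛ^∞⟮I; F, A⟯ × C^∞⟮I, Q; ℝ⟯) : dObs μ (r (dObs μ u) - u) = 0 := by
    rw [map_sub, sub_eq_zero]
    exact dObs_dObsRightInverse μ (dObs μ u)
  have h1 := 𝒜.obs_pairBracket_eq_zero (h s) (r (dObs μ t))
  have h2 := 𝒜.obs_pairBracket_eq_zero (h t) s
  rw [𝒜.pairBracket_skew] at h2
  simp only [map_sub, map_neg, LinearMap.sub_apply, Pi.sub_apply, Pi.neg_apply] at h1 h2
  linarith

end LieAlgebroid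

variable [FiniteDimensional ℝ F] [ContMDiffVectorBundle ∞ F A I]

theorem isBivectorField_of_dObs {𝒜 : LieAlgebroid I F A}
    {Λ : BilinField (dualModel I F) (DualTotal F A)}
    (h : ∀ μ s t, Λ μ (dObs μ s) (dObs μ t) = obs (𝒜.pairBracket s t) μ) :
    IsBivectorField (dualModel I F) Λ where
  alt μ α := by
    obtain ⟨s, rfl⟩ := dObs_surjective μ α
    have h1 := congrFun (congrArg obs (𝒜.pairBracket_skew s s)) μ
    rw [map_neg, Pi.neg_apply] at h1
    rw [h]
    linarith
  smooth μ₀ α β μ hμ := by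
    obtain ⟨s, hs⟩ := exists_chartCovector_eq hμ α
    obtain ⟨t, ht⟩ := exists_chartCovector_eq hμ β
    exact ((contMDiff_obs (𝒜.pairBracket s t) μ).congr_of_eventuallyEq
      (bivComp_eventuallyEq hs ht fun ν => h ν s t)).contMDiffWithinAt

theorem isAssociated_of_dObs {𝒜 : LieAlgebroid I F A}
    {Λ : BilinField (dualModel I F) (DualTotal F A)}
    (h : ∀ μ s t, Λ μ (dObs μ s) (dObs μ t) = obs (𝒜.pairBracket s t) μ) :
    IsAssociated I F A 𝒜 Λ where
  isBivectorField := isBivectorField_of_dObs h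
  hat_hat X Y μ := by
    rw [← dObs_section, ← dObs_section, h]
    simp [LieAlgebroid.pairBracket_apply, obs_apply]
  hat_base X f μ := by
    rw [← dObs_section, ← dObs_function, h]
    simp [LieAlgebroid.pairBracket_apply, obs_apply, hat, LieAlgebroid.anchorDer_apply]
  base_base f g μ := by
    rw [← dObs_function, ← dObs_function, h]
    simp [LieAlgebroid.pairBracket_apply, obs_apply, hat]

theorem existsUnique_isAssociated (𝒜 : LieAlgebroid I F A) :
    ∃! Λ : BilinField (dualModel I F) (DualTotal F A), IsAssociated I F A 𝒜 Λ := by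
  refine ⟨𝒜.dualBivector, isAssociated_of_dObs 𝒜.dualBivector_dObs, fun Λ hΛ => ?_⟩
  funext μ
  refine LinearMap.ext₂ fun α β => ?_
  obtain ⟨s, rfl⟩ := dObs_surjective μ α
  obtain ⟨t, rfl⟩ := dObs_surjective μ β
  rw [hΛ.apply_dObs, 𝒜.dualBivector_dObs]

theorem IsAssociated.isPoissonBivector {𝒜 : LieAlgebroid I F A}
    {Λ : BilinField (dualModel I F) (DualTotal F A)} (h : IsAssociated I F A 𝒜 Λ) :
    IsPoissonBivector (dualModel I F) Λ where
  isBivectorField := h.isBivectorField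
  schouten_self μ α β γ := by
    obtain ⟨s, hs⟩ := exists_chartCovector_eq (mem_chart_source _ μ) α
    obtain ⟨t, ht⟩ := exists_chartCovector_eq (mem_chart_source _ μ) β
    obtain ⟨u, hu⟩ := exists_chartCovector_eq (mem_chart_source _ μ) γ
    rw [schouten_self_eq hs ht hu (fun ν => h.apply_dObs ν s t) (fun ν => h.apply_dObs ν t u)
      (fun ν => h.apply_dObs ν u s)]
    simp only [← dObs_apply]
    rw [h.apply_dObs, h.apply_dObs, h.apply_dObs, ← Pi.add_apply, ← Pi.add_apply, ← map_add,
      ← map_add, 𝒜.pairBracket_jacobi]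
    simp

end LinearPoisson

section Reeb

variable {E : Type*} [NormedAddCommGroup E] [NormedSpace ℝ E]
  {H : Type*} [TopologicalSpace H] {I : ModelWithCorners ℝ E H}
  {M : Type*} [TopologicalSpace M] [ChartedSpace H M]

theorem reeb_eq (p : M × ℝ) : reeb I p = ((0 : E), (1 : ℝ)) := by
  rw [reeb, mfderiv_prod_right]
  rfl

theorem isVectorField_neg_reeb [IsManifold I ∞ M] :
    IsVectorField (I.prod 𝓘(ℝ, ℝ)) (fun p : M × ℝ => -reeb I p) := by
  have : IsManifold I 1 M := IsManifold.of_le (n := ∞) (by simp)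
  have h1 : ContMDiff (I.prod 𝓘(ℝ, ℝ)) I.tangent ∞
      fun p : M × ℝ => (⟨p.1, 0⟩ : TangentBundle I M) :=
    (contMDiff_zeroSection ℝ (TangentSpace I : M → Type _)).comp contMDiff_fst
  have h2 : ContMDiff (I.prod 𝓘(ℝ, ℝ)) 𝓘(ℝ, ℝ).tangent ∞
      fun p : M × ℝ => (⟨p.2, (-1 : ℝ)⟩ : TangentBundle 𝓘(ℝ, ℝ) ℝ) :=
    (contMDiff_vectorSpace_iff_contDiff.2 contDiff_const).comp contMDiff_snd
  have h3 := contMDiff_equivTangentBundleProd_symm.comp (h1.prodMk h2)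
  have h4 (p : M × ℝ) : -reeb I p = ((0 : E), (-1 : ℝ)) := by
    rw [reeb_eq]
    exact Prod.ext neg_zero rfl
  unfold IsVectorField
  simp only [h4]
  exact h3

end Reeb

section Contact

variable {E : Type*} [NormedAddCommGroup E] [NormedSpace ℝ E]
  {H : Type*} [TopologicalSpace H] {I : ModelWithCorners ℝ E H}
  {Q : Type*} [TopologicalSpace Q] [ChartedSpace H Q]
  {F : Type*} [NormedAddCommGroup F] [NormedSpace ℝ F]
  {A : Q → Type*} [TopologicalSpace (TotalSpace F A)]
  [∀ q, AddCommGroup (A q)] [∀ q, Module ℝ (A q)] [∀ q, TopologicalSpace (A q)]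
  [FiberBundle F A] [VectorBundle ℝ F A]

theorem mdifferentiableAt_dilation (μ : DualTotal F A) (t₀ : ℝ) :
    MDifferentiableAt 𝓘(ℝ, ℝ) (dualModel I F)
      (fun t : ℝ => (⟨μ.1, μ.2 + t • μ.2⟩ : DualTotal F A)) t₀ := by
  rw [mdifferentiableAt_totalSpace]
  refine ⟨mdifferentiableAt_const, ?_⟩
  set e := trivializationAt (F →L[ℝ] ℝ) (Dual A) μ.1
  have hμ : μ.1 ∈ e.baseSet := mem_baseSet_trivializationAt _ _ _
  have h (t : ℝ) : (e ⟨μ.1, μ.2 + t • μ.2⟩).2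
      = e.linearMapAt ℝ μ.1 μ.2 + t • e.linearMapAt ℝ μ.1 μ.2 := by
    rw [← map_smul, ← map_add, e.coe_linearMapAt_of_mem hμ]
  simp only [h]
  exact ((differentiableAt_const _).add (differentiableAt_id.smul_const _)).mdifferentiableAt

/-- The function `X^ + f ∘ π + c z` on `A* × ℝ`. -/
def contactObs (s : Cₛ^∞⟮I; F, A⟯ × C^∞⟮I, Q; ℝ⟯) (c : ℝ) (p : DualTotal F A × ℝ) : ℝ :=
  obs s p.1 + c * p.2

/-- The differential of `X^ + f ∘ π + c z`. -/
abbrev dContactObs (s : Cₛ^∞⟮I; F, A⟯ × C^∞⟮I, Q; ℝ⟯) (c : ℝ) (p : DualTotal F A × ℝ) :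
    Cotangent (contactModel I F) p :=
  d (contactModel I F) (contactObs s c) p

variable [ContMDiffVectorBundle ∞ F A I]

theorem contMDiff_contactObs (s : Cₛ^∞⟮I; F, A⟯ × C^∞⟮I, Q; ℝ⟯) (c : ℝ) :
    ContMDiff (contactModel I F) 𝓘(ℝ, ℝ) ∞ (contactObs s c) :=
  ((contMDiff_obs s).comp contMDiff_fst).add (contMDiff_const.mul contMDiff_snd)

theorem mdifferentiableAt_contactObs (s : Cₛ^∞⟮I; F, A⟯ × C^∞⟮I, Q; ℝ⟯) (c : ℝ)
    (p : DualTotal F A × ℝ) :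
    MDifferentiableAt (contactModel I F) 𝓘(ℝ, ℝ) (contactObs s c) p :=
  (contMDiff_contactObs s c).mdifferentiable (by simp) p

theorem dContactObs_reeb (s : Cₛ^∞⟮I; F, A⟯ × C^∞⟮I, Q; ℝ⟯) (c : ℝ)
    (p : DualTotal F A × ℝ) : dContactObs s c p (reeb (dualModel I F) p) = c := by
  have h1 : MDifferentiableAt 𝓘(ℝ, ℝ) (contactModel I F) (fun z : ℝ => (p.1, z)) p.2 :=
    mdifferentiableAt_const.prodMk mdifferentiableAt_id
  have h2 := mfderiv_comp_apply_of_eq p.2 (mdifferentiableAt_contactObs s c p) h1 rfl (1 : ℝ)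
  refine h2.symm.trans ?_
  have h3 : HasDerivAt (contactObs s c ∘ fun z : ℝ => (p.1, z)) c p.2 := by
    have h4 := ((hasDerivAt_id p.2).const_mul c).const_add (obs s p.1)
    rwa [mul_one] at h4
  rw [mfderiv_eq_fderiv]
  exact h3.deriv

theorem dContactObs_comp_slice (s : Cₛ^∞⟮I; F, A⟯ × C^∞⟮I, Q; ℝ⟯) (c : ℝ)
    (p : DualTotal F A × ℝ) :
    (dContactObs s c p).comp
      (mfderiv (dualModel I F) (contactModel I F) (fun y : DualTotal F A => (y, p.2)) p.1)
      = dObs p.1 s := by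
  have h1 : MDifferentiableAt (dualModel I F) (contactModel I F)
      (fun y : DualTotal F A => (y, p.2)) p.1 :=
    mdifferentiableAt_id.prodMk mdifferentiableAt_const
  have h2 := mfderiv_comp_of_eq (mdifferentiableAt_contactObs s c p) h1 rfl
  refine h2.symm.trans ?_
  have h3 := d_add (mdifferentiableAt_obs s p.1)
    (mdifferentiableAt_const (I := dualModel I F) (I' := 𝓘(ℝ, ℝ)) (c := c * p.2))
  rw [d_const, add_zero] at h3
  exact h3

theorem dContactObs_liouville (s : Cₛ^∞⟮I; F, A⟯ × C^∞⟮I, Q; ℝ⟯) (c : ℝ)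
    (p : DualTotal F A × ℝ) :
    dContactObs s c p (liouville I F A p) = obs (LieAlgebroid.sectionPart s) p.1 := by
  have h1 : MDifferentiableAt 𝓘(ℝ, ℝ) (contactModel I F)
      (fun t : ℝ => ((⟨p.1.1, p.1.2 + t • p.1.2⟩ : DualTotal F A), p.2)) 0 :=
    (mdifferentiableAt_dilation p.1 0).prodMk mdifferentiableAt_const
  have h2 := mfderiv_comp_apply_of_eq 0 (mdifferentiableAt_contactObs s c p) h1
    (by rw [zero_smul, add_zero]) (1 : ℝ)
  refine h2.symm.trans ?_
  have h3 : contactObs s c ∘ (fun t : ℝ => ((⟨p.1.1, p.1.2 + t • p.1.2⟩ : DualTotal F A), p.2))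
      = fun t => contactObs s c p + t * hat s.1 p.1 := by
    ext t
    have h4 : hat s.1 (⟨p.1.1, p.1.2 + t • p.1.2⟩ : DualTotal F A)
        = hat s.1 p.1 + t * hat s.1 p.1 := rfl
    simp only [Function.comp_apply, contactObs, obs_apply, h4]
    ring
  have h5 : HasDerivAt (fun t => contactObs s c p + t * hat s.1 p.1) (hat s.1 p.1) (0 : ℝ) := by
    simpa using ((hasDerivAt_id (0 : ℝ)).mul_const (hat s.1 p.1)).const_add (contactObs s c p)
  rw [h3, mfderiv_eq_fderiv]
  refine h5.deriv.trans ?_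
  exact (add_zero _).symm

theorem contactBivector_apply [IsManifold I ∞ Q] {𝒜 : LieAlgebroid I F A}
    {Λ : BilinField (dualModel I F) (DualTotal F A)} (h : IsAssociated I F A 𝒜 Λ)
    (s t : Cₛ^∞⟮I; F, A⟯ × C^∞⟮I, Q; ℝ⟯) (c c' : ℝ) (p : DualTotal F A × ℝ) :
    contactBivector I F A Λ p (dContactObs s c p) (dContactObs t c' p)
      = contactObs (𝒜.pairBracket s t + c' • LieAlgebroid.sectionPart s
          - c • LieAlgebroid.sectionPart t) 0 p := by
  have h1 : pullbackFst (dualModel I F) Λ p (dContactObs s c p) (dContactObs t c' p)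
      = obs (𝒜.pairBracket s t) p.1 := by
    rw [← h.apply_dObs, ← dContactObs_comp_slice s c p, ← dContactObs_comp_slice t c' p]
    rfl
  have h2 : wedge (contactModel I F) (liouville I F A) (reeb (dualModel I F)) p
      (dContactObs s c p) (dContactObs t c' p)
      = obs (LieAlgebroid.sectionPart s) p.1 * c' - c * obs (LieAlgebroid.sectionPart t) p.1 := by
    rw [← dContactObs_liouville s c p, ← dContactObs_liouville t c' p]
    nth_rw 2 [← dContactObs_reeb t c' p]
    nth_rw 3 [← dContactObs_reeb s c p]
    rfl
  refine (congrArg₂ (· + ·) h1 h2).trans ?_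
  simp only [contactObs, map_add, map_sub, map_smul, Pi.add_apply, Pi.sub_apply, Pi.smul_apply,
    smul_eq_mul]
  ring

end Contact

section Jacobi

variable {E : Type*} [NormedAddCommGroup E] [NormedSpace ℝ E] [FiniteDimensional ℝ E]
  {H : Type*} [TopologicalSpace H] {I : ModelWithCorners ℝ E H}
  {Q : Type*} [TopologicalSpace Q] [T2Space Q] [ChartedSpace H Q] [IsManifold I ∞ Q]
  {F : Type*} [NormedAddCommGroup F] [NormedSpace ℝ F] [FiniteDimensional ℝ F]
  {A : Q → Type*} [TopologicalSpace (TotalSpace F A)]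
  [∀ q, AddCommGroup (A q)] [∀ q, Module ℝ (A q)] [∀ q, TopologicalSpace (A q)]
  [FiberBundle F A] [VectorBundle ℝ F A]
  [ContMDiffVectorBundle ∞ F A I]

theorem exists_chartCovector_eq_dContactObs {p₀ p : DualTotal F A × ℝ}
    (h : p ∈ (chartAt (ModelProd (ModelProd H (F →L[ℝ] ℝ)) ℝ) p₀).source)
    (α : Cotangent (contactModel I F) p₀) :
    ∃ (s : Cₛ^∞⟮I; F, A⟯ × C^∞⟮I, Q; ℝ⟯) (c : ℝ),
      ∀ᶠ x in 𝓝 p, chartCovector (contactModel I F) p₀ α x = dContactObs s c x := by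
  let α' : ((E × (F →L[ℝ] ℝ)) × ℝ) →L[ℝ] ℝ := α
  have h' : p.1 ∈ (chartAt (ModelProd H (F →L[ℝ] ℝ)) p₀.1).source := by
    rw [prodChartedSpace_chartAt] at h
    exact h.1
  obtain ⟨s, hs⟩ := exists_obs_eventuallyEq (I := I) h'
    (α'.comp (ContinuousLinearMap.inl ℝ (E × (F →L[ℝ] ℝ)) ℝ))
  have hs' : contactObs s (α' (0, 1)) =ᶠ[𝓝 p]
      fun x => α' (extChartAt (contactModel I F) p₀ x) := by
    filter_upwards [continuous_fst.continuousAt.eventually hs] with x hx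
    have h1 : extChartAt (contactModel I F) p₀ x
        = (extChartAt (dualModel I F) p₀.1 x.1, x.2) := by
      rw [extChartAt_prod]
      rfl
    have h2 : (extChartAt (dualModel I F) p₀.1 x.1, x.2)
        = (extChartAt (dualModel I F) p₀.1 x.1, (0 : ℝ))
          + x.2 • ((0 : E × (F →L[ℝ] ℝ)), (1 : ℝ)) := by
      simp
    rw [contactObs, hx, h1, h2, map_add, map_smul, smul_eq_mul, mul_comm]
    rfl
  refine ⟨s, α' (0, 1), ?_⟩
  filter_upwards [hs'.eventually_nhds, (chartAt _ p₀).open_source.mem_nhds h] with x hx hx'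
  exact ((d_congr hx).trans (d_comp_extChartAt hx' _)).symm

theorem dContactObs_surjective (p : DualTotal F A × ℝ) (α : Cotangent (contactModel I F) p) :
    ∃ (s : Cₛ^∞⟮I; F, A⟯ × C^∞⟮I, Q; ℝ⟯) (c : ℝ), dContactObs s c p = α := by
  obtain ⟨s, c, hs⟩ := exists_chartCovector_eq_dContactObs (mem_chart_source _ p) α
  exact ⟨s, c, by rw [← hs.self_of_nhds, chartCovector_self]⟩

theorem IsAssociated.isJacobiStructure {𝒜 : LieAlgebroid I F A}
    {Λ : BilinField (dualModel I F) (DualTotal F A)} (h : IsAssociated I F A 𝒜 Λ) :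
    IsJacobiStructure (contactModel I F) (contactBivector I F A Λ)
      (fun p => -reeb (dualModel I F) p) where
  isBivectorField :=
    { alt := fun p α => by
        obtain ⟨s, c, rfl⟩ := dContactObs_surjective p α
        have h1 := congrFun (congrArg obs (𝒜.pairBracket_skew s s)) p.1
        rw [map_neg, Pi.neg_apply] at h1
        rw [contactBivector_apply h, add_sub_cancel_right, contactObs]
        linarith
      smooth := fun p₀ α β p hp => by
        obtain ⟨s, c, hs⟩ := exists_chartCovector_eq_dContactObs hp α
        obtain ⟨t, c', ht⟩ := exists_chartCovector_eq_dContactObs hp β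
        exact ((contMDiff_contactObs _ _ p).congr_of_eventuallyEq
          (bivComp_eventuallyEq hs ht fun x => contactBivector_apply h s t c c' x))
          |>.contMDiffWithinAt }
  isVectorField := isVectorField_neg_reeb
  schouten_self p α β γ := by
    obtain ⟨s, c, hs⟩ := exists_chartCovector_eq_dContactObs (mem_chart_source _ p) α
    obtain ⟨t, c', ht⟩ := exists_chartCovector_eq_dContactObs (mem_chart_source _ p) β
    obtain ⟨u, c'', hu⟩ := exists_chartCovector_eq_dContactObs (mem_chart_source _ p) γ
    rw [schouten_self_eq hs ht hu (fun x => contactBivector_apply h s t c c' x)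
      (fun x => contactBivector_apply h t u c' c'' x)
      (fun x => contactBivector_apply h u s c'' c x)]
    have eα := (chartCovector_self p α).symm.trans hs.self_of_nhds
    have eβ := (chartCovector_self p β).symm.trans ht.self_of_nhds
    have eγ := (chartCovector_self p γ).symm.trans hu.self_of_nhds
    rw [eα, eβ, eγ, wedgeBiv, contactBivector_apply h, contactBivector_apply h,
      contactBivector_apply h, contactBivector_apply h, contactBivector_apply h,
      contactBivector_apply h, map_neg, map_neg, map_neg, dContactObs_reeb, dContactObs_reeb,
      dContactObs_reeb]
    have hj := congrFun (congrArg obs (𝒜.pairBracket_jacobi s t u)) p.1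
    have hP (v w : Cₛ^∞⟮I; F, A⟯ × C^∞⟮I, Q; ℝ⟯) :=
      congrFun (congrArg obs (𝒜.sectionPart_pairBracket v w)) p.1
    have hskew (v w : Cₛ^∞⟮I; F, A⟯ × C^∞⟮I, Q; ℝ⟯) :=
      congrFun (congrArg obs (𝒜.pairBracket_skew v w)) p.1
    have hPP (v : Cₛ^∞⟮I; F, A⟯ × C^∞⟮I, Q; ℝ⟯) :
        LieAlgebroid.sectionPart (LieAlgebroid.sectionPart v) = LieAlgebroid.sectionPart v := rfl
    have h1 := hP s t
    have h2 := hP t u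
    have h3 := hP u s
    have k1 := hskew s (LieAlgebroid.sectionPart t)
    have k2 := hskew t (LieAlgebroid.sectionPart u)
    have k3 := hskew u (LieAlgebroid.sectionPart s)
    simp only [contactObs, map_add, map_sub, map_smul, map_neg, map_zero, hPP,
      LinearMap.add_apply, LinearMap.sub_apply, LinearMap.smul_apply, Pi.add_apply, Pi.sub_apply,
      Pi.smul_apply, Pi.neg_apply, Pi.zero_apply, smul_eq_mul] at *
    linear_combination 2 * hj + 2 * c'' * h1 + 2 * c * h2 + 2 * c' * h3 + 2 * c'' * k1
      + 2 * c * k2 + 2 * c' * k3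
  schouten_vec p α β := by
    obtain ⟨s, c, hs⟩ := exists_chartCovector_eq_dContactObs (mem_chart_source _ p) α
    obtain ⟨t, c', ht⟩ := exists_chartCovector_eq_dContactObs (mem_chart_source _ p) β
    have hv {γ : Cotangent (contactModel I F) p} {u : Cₛ^∞⟮I; F, A⟯ × C^∞⟮I, Q; ℝ⟯} {k : ℝ}
        (hu : ∀ᶠ x in 𝓝 p, chartCovector (contactModel I F) p γ x = dContactObs u k x) :
        d (contactModel I F)
          (vecComp (contactModel I F) (fun p => -reeb (dualModel I F) p) p γ) p = 0 := by
      have h1 : vecComp (contactModel I F) (fun p => -reeb (dualModel I F) p) p γ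
          =ᶠ[𝓝 p] fun _ => -k := by
        filter_upwards [hu] with x hx
        rw [vecComp, hx, map_neg, dContactObs_reeb]
      rw [d_congr h1, d_const]
    rw [schoutenVec, hv hs, hv ht, map_zero, map_zero, LinearMap.zero_apply,
      d_congr (bivComp_eventuallyEq hs ht fun x => contactBivector_apply h s t c c' x), map_neg,
      dContactObs_reeb]
    simp

end Jacobi

end LieAlgd

end

theorem theorem2
    {E : Type*} [NormedAddCommGroup E] [NormedSpace ℝ E] [FiniteDimensional ℝ E]
    {H : Type*} [TopologicalSpace H] (I : ModelWithCorners ℝ E H) [I.Boundaryless]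
    {Q : Type*} [TopologicalSpace Q] [T2Space Q] [ChartedSpace H Q] [IsManifold I ∞ Q]
    (F : Type*) [NormedAddCommGroup F] [NormedSpace ℝ F] [FiniteDimensional ℝ F]
    (A : Q → Type*) [TopologicalSpace (TotalSpace F A)]
    [∀ q, AddCommGroup (A q)] [∀ q, Module ℝ (A q)] [∀ q, TopologicalSpace (A q)]
    [FiberBundle F A] [VectorBundle ℝ F A]
    [∀ q, IsTopologicalAddGroup (A q)] [∀ q, ContinuousSMul ℝ (A q)]
    [ContMDiffVectorBundle ∞ F A I]
    (𝒜 : LieAlgd.LieAlgebroid I F A) :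
    (∃! Λ : LieAlgd.BilinField (LieAlgd.dualModel I F) (LieAlgd.DualTotal F A),
      LieAlgd.IsAssociated I F A 𝒜 Λ) ∧
    ∀ Λ : LieAlgd.BilinField (LieAlgd.dualModel I F) (LieAlgd.DualTotal F A),
      LieAlgd.IsAssociated I F A 𝒜 Λ →
        LieAlgd.IsPoissonBivector (LieAlgd.dualModel I F) Λ ∧
        LieAlgd.IsJacobiStructure (LieAlgd.contactModel I F)
          (LieAlgd.contactBivector I F A Λ)
          (fun p => -LieAlgd.reeb (LieAlgd.dualModel I F) p) := by
  exact ⟨LieAlgd.existsUnique_isAssociated 𝒜,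
    fun _ hΛ => ⟨hΛ.isPoissonBivector, hΛ.isJacobiStructure⟩⟩
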